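/- Packets arrive at a sender according to a Poisson process of rate $\lambda>0$. Each packet independently has length $\ell_{\min}$ with probability $p>0$ or length $\ell_{\max}$ with probability $q>0$, where $p+q=1$ and $0<\ell_{\min}<\ell_{\max}$; put $\rho=\ell_{\max}/\ell_{\min}$. The sender transmits packets one at a time over a link; transmitting a packet takes time equal to its length. An adversary places instantaneous errors on the link, finitely many in bounded time: an adversarial error function $E$ assigns (measurably) to each arrival pattern $A$ a set of error times, such that the errors up to time $t$ depend only on the arrivals up to time $t$. An error strictly inside a transmission corrupts it; the sender is notified at that instant, and the packet remains pending. For an algorithm $\mathrm{Alg}$ let $L_{\mathrm{Alg}}(A,E,t)$ be the total length of the packets it has successfully transmitted by time $t$, and let $L_{\mathrm{OPT}}(A,E,t)$ be the maximum of this quantity over all offline schedules, which know all arrivals and errors in advance (but transmit packets only after their arrival). It is required of $E$ that $L_{\mathrm{OPT}}(A,E,t)$ be unbounded as $t\to\infty$ for every arrival pattern $A$ (with arrival times increasing to infinity and infinitely many packets of each length). The relative throughput of $\mathrm{Alg}$ is $$T_{\mathrm{Alg}}=\inf_{E}\ \limsup_{t\to\infty}\ \mathbb{E}_A\!\left[\frac{L_{\mathrm{Alg}}(A,E,t)}{L_{\mathrm{OPT}}(A,E,t)}\right],$$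 where the ratio is $1$ if numerator and denominator are both $0$. Algorithm $\mathrm{SL}$ (Shortest Length) acts as follows whenever it has to choose a packet (at the start, after a completed transmission, after an error that hits its transmission, and when a packet arrives while it is idle with nothing pending): it transmits an $\ell_{\min}$ packet if one is pending, otherwise an $\ell_{\max}$ packet if one is pending, and otherwise it idles until the next arrival. Theorem. Let $0<\ell_{\min}<\ell_{\max}$. For every $\varepsilon>0$ with $(1-\varepsilon)\rho+1>0$ (in particular for every $0<\varepsilon\le 1$) there exist $\lambda>0$ and $p,q>0$ with $p+q=1$ such that the relative throughput of $\mathrm{SL}$ under stochastic arrivals satisfies $$T_{\mathrm{SL}}\le\frac{1}{(1-\varepsilon)\rho+1}+\varepsilon .$$ -/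

import Mathlib

open MeasureTheory ProbabilityTheory Filter Set

noncomputable section

namespace PacketScheduling

/-! ### Packets and arrivals -/

/-- An arrival pattern: packet number `i` arrives at time `(A i).1`; its length is `ℓmin` if
`(A i).2 = true` and `ℓmax` if `(A i).2 = false`. -/
abbrev Pattern : Type := ℕ → ℝ × Bool

/-- The length (equivalently, the transmission time) of a packet of the given kind. -/
def len (lmin lmax : ℝ) (short : Bool) : ℝ := if short then lmin else lmax

/-- The genuine realizations of the arrival process: arrival times are positive, increasing, tend
to infinity, and packets of each of the two lengths keep arriving. Almost every pattern drawn from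
`arrivalLaw` is of this form. -/
structure IsRealization (A : Pattern) : Prop where
  pos : ∀ i, 0 < (A i).1
  strictMono : StrictMono fun i => (A i).1
  tendsto : Tendsto (fun i => (A i).1) atTop atTop
  infinite_kind : ∀ b : Bool, {i | (A i).2 = b}.Infinite

/-- The number of packets of kind `b` that have arrived by time `t`. -/
def arrived (A : Pattern) (b : Bool) (t : ℝ) : ℕ := {i | (A i).2 = b ∧ (A i).1 ≤ t}.ncard

/-- The law of the kind of a packet: `ℓmin` with probability `p`, `ℓmax` with probability `q`. -/
def kindLaw (p q : ℝ) : Measure Bool :=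
  ENNReal.ofReal p • Measure.dirac true + ENNReal.ofReal q • Measure.dirac false

/-- Turns (inter-arrival times, kinds) into an arrival pattern. -/
def ofGaps (g : ℕ → ℝ × Bool) : Pattern :=
  fun n => (∑ i ∈ Finset.range (n + 1), (g i).1, (g n).2)

/-- The law of the arrival pattern: a Poisson process of rate `lam` (independent exponential
inter-arrival times), each packet independently being of length `ℓmin` with probability `p` and of
length `ℓmax` with probability `q`. -/
def arrivalLaw (lam p q : ℝ) : Measure Pattern :=
  (Measure.infinitePi fun _ : ℕ => (expMeasure lam).prod (kindLaw p q)).map ofGaps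

lemma measurable_ofGaps : Measurable ofGaps := by
  unfold ofGaps
  fun_prop

lemma isProbabilityMeasure_kindLaw {p q : ℝ} (hp : 0 < p) (hq : 0 < q) (hpq : p + q = 1) :
    IsProbabilityMeasure (kindLaw p q) := by
  refine ⟨?_⟩
  simp [kindLaw, ← ENNReal.ofReal_add hp.le hq.le, hpq]

lemma isProbabilityMeasure_arrivalLaw {lam p q : ℝ} (hlam : 0 < lam) (hp : 0 < p) (hq : 0 < q)
    (hpq : p + q = 1) : IsProbabilityMeasure (arrivalLaw lam p q) := by
  have := isProbabilityMeasure_expMeasure hlam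
  have := isProbabilityMeasure_kindLaw hp hq hpq
  exact Measure.isProbabilityMeasure_map measurable_ofGaps.aemeasurable

/-! ### Errors -/

/-- A packet occupying the link from time `s` to time `s + l` is corrupted if an error occurs
strictly between these two times. -/
def Corrupted (Err : Set ℝ) (s l : ℝ) : Prop := ∃ e ∈ Err, s < e ∧ e < s + l

/-- The patterns `A` and `A'` have the same arrivals (times and lengths) up to time `t`. -/
def AgreeUpTo (t : ℝ) (A A' : Pattern) : Prop :=
  ∀ i, (A i).1 ≤ t ∨ (A' i).1 ≤ t → A i = A' i

/-! ### The optimal offline algorithm -/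

/-- An offline schedule by time `t`: the packets in `S` are transmitted, packet `i` starting at
time `start i`, after its arrival, without corruption, completed by time `t`, and never two
packets at once. -/
structure IsSchedule (lmin lmax : ℝ) (A : Pattern) (Err : Set ℝ) (t : ℝ)
    (S : Finset ℕ) (start : ℕ → ℝ) : Prop where
  arrived : ∀ i ∈ S, (A i).1 ≤ start i
  completed : ∀ i ∈ S, start i + len lmin lmax (A i).2 ≤ t
  not_corrupted : ∀ i ∈ S, ¬ Corrupted Err (start i) (len lmin lmax (A i).2)
  disjoint : ∀ i ∈ S, ∀ j ∈ S, i ≠ j →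
    start i + len lmin lmax (A i).2 ≤ start j ∨ start j + len lmin lmax (A j).2 ≤ start i

/-- `L_OPT(A, E, t)`: the largest total length of packets that can be successfully transmitted by
time `t` by a schedule knowing all arrivals and all errors. -/
def optLength (lmin lmax : ℝ) (A : Pattern) (Err : Set ℝ) (t : ℝ) : ℝ :=
  sSup {v | ∃ (S : Finset ℕ) (start : ℕ → ℝ), IsSchedule lmin lmax A Err t S start ∧
    v = ∑ i ∈ S, len lmin lmax (A i).2}

/-! ### Algorithm SL (Shortest Length) -/

/-- The state of algorithm SL at a time at which the link is free: the current time and the numbers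
of `ℓmin` and `ℓmax` packets successfully transmitted so far. -/
structure SLState where
  time : ℝ
  sentShort : ℕ
  sentLong : ℕ

/-- One scheduling decision of SL. If an `ℓmin` packet is pending, it transmits one; otherwise, if
an `ℓmax` packet is pending, it transmits one; otherwise it waits for the next arrival. A
transmission without error runs to completion; a transmission hit by an error stops at the time of
the error (instantaneous feedback), the packet stays pending, and SL decides anew. -/
def slStep (lmin lmax : ℝ) (A : Pattern) (Err : Set ℝ) (s : SLState) : SLState :=
  open Classical in
  if s.sentShort < arrived A true s.time then
    if Corrupted Err s.time lmin then { s with time := sInf (Err ∩ Ioi s.time) }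
    else { s with time := s.time + lmin, sentShort := s.sentShort + 1 }
  else if s.sentLong < arrived A false s.time then
    if Corrupted Err s.time lmax then { s with time := sInf (Err ∩ Ioi s.time) }
    else { s with time := s.time + lmax, sentLong := s.sentLong + 1 }
  else { s with time := sInf ((range fun i => (A i).1) ∩ Ioi s.time) }

/-- The state of SL at its `k`-th decision, starting at time `0` with nothing transmitted. -/
def slState (lmin lmax : ℝ) (A : Pattern) (Err : Set ℝ) : ℕ → SLState
  | 0 => ⟨0, 0, 0⟩
  | k + 1 => slStep lmin lmax A Err (slState lmin lmax A Err k)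

/-- `L_SL(A, E, t)`: the total length of the packets successfully transmitted by SL by time `t`. -/
def slLength (lmin lmax : ℝ) (A : Pattern) (Err : Set ℝ) (t : ℝ) : ℝ :=
  sSup {v | ∃ k, (slState lmin lmax A Err k).time ≤ t ∧
    v = (slState lmin lmax A Err k).sentShort * lmin +
      (slState lmin lmax A Err k).sentLong * lmax}

/-! ### Adversaries and relative throughput -/

/-- An adversarial error function `E`, giving the set `E A` of error times in response to the
arrival pattern `A`. It depends measurably on `A`, produces finitely many errors in bounded time,
decides about errors up to time `t` knowing only the arrivals up to time `t` (the algorithm being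
deterministic, these also determine its behaviour so far), and allows non-trivial communication. -/
structure IsErrorFunction (lmin lmax : ℝ) (E : Pattern → Set ℝ) : Prop where
  measurable : MeasurableSet {x : ℝ × Pattern | x.1 ∈ E x.2}
  locallyFinite : ∀ A, IsRealization A → ∀ t, (E A ∩ Icc 0 t).Finite
  nonanticipating : ∀ A A', IsRealization A → IsRealization A' →
    ∀ t, AgreeUpTo t A A' → E A ∩ Iic t = E A' ∩ Iic t
  nontrivial : ∀ A, IsRealization A → ∀ M : ℝ, ∃ t, M < optLength lmin lmax A (E A) t

/-- The relative throughput by time `t` of an algorithm for which `L A Err t` is the total length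
successfully transmitted by time `t`. -/
def throughputBy (lmin lmax : ℝ) (L : Pattern → Set ℝ → ℝ → ℝ)
    (A : Pattern) (Err : Set ℝ) (t : ℝ) : ℝ :=
  open Classical in
  if L A Err t = 0 ∧ optLength lmin lmax A Err t = 0 then 1
  else L A Err t / optLength lmin lmax A Err t

/-- The (upper) expectation of a nonnegative function. It is the expectation if `f` is measurable;
in general it is the infimum of the expectations of the measurable functions above `f`. -/
def expectation {Ω : Type*} [MeasurableSpace Ω] (μ : Measure Ω) (f : Ω → ℝ) : ENNReal :=
  ⨅ (g : Ω → ENNReal) (_ : Measurable g) (_ : ∀ᵐ ω ∂μ, ENNReal.ofReal (f ω) ≤ g ω),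
    ∫⁻ ω, g ω ∂μ

/-- `expectation` is the ordinary expectation on measurable functions. -/
lemma expectation_eq_lintegral {Ω : Type*} [MeasurableSpace Ω] (μ : Measure Ω) {f : Ω → ℝ}
    (hf : Measurable f) : expectation μ f = ∫⁻ ω, ENNReal.ofReal (f ω) ∂μ := by
  refine le_antisymm ?_ ?_
  · exact iInf_le_of_le _ (iInf_le_of_le hf.ennreal_ofReal
      (iInf_le_of_le (Eventually.of_forall fun _ => le_rfl) le_rfl))
  · exact le_iInf fun g => le_iInf fun _ => le_iInf fun hg => lintegral_mono_ae hg

/-- The relative throughput, under stochastic arrivals with parameters `lam, p, q`, of an algorithm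
with transmitted length `L`: the infimum over all adversarial error functions of the long-term
value of the expected relative throughput by time `t`. The upper limit is taken, which is the
limit whenever the limit exists. -/
def relativeThroughput (lmin lmax lam p q : ℝ) (L : Pattern → Set ℝ → ℝ → ℝ) : ENNReal :=
  ⨅ (E : Pattern → Set ℝ) (_ : IsErrorFunction lmin lmax E),
    limsup (fun t : ℝ =>
      expectation (arrivalLaw lam p q) fun A => throughputBy lmin lmax L A (E A) t) atTop

end PacketScheduling

end

noncomputable section

namespace PacketScheduling

variable {lmin lmax : ℝ} {A : Pattern} {Err : Set ℝ}

/-! ### Offline schedules -/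

/-! The adversary watches for isolated short packets, those arriving more than `lmax + lmin` after
the previous arrival. Each opens two slots, of lengths `lmax` and `lmin`, with errors at their
borders and none inside; elsewhere, errors at the multiples of `lmin` leave no room for a long
packet. A long transmission can then succeed only if it starts exactly when a short packet arrives
(`exists_short_of_not_corrupted`), and at that instant SL prefers the short one. So SL never
completes a long packet and earns at most `lmin` per short arrival (`slLength_le_arrived`). An
offline schedule fills the first slot with an old long packet and the second with the isolated
packet, earning `lmax + lmin` per isolated packet (`exists_slot_schedule`); taking `p < 1/2` keeps
long packets in supply.

By the strong law, short packets have frequency `p` and isolated ones `p * exp (-(lam * (lmax +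
lmin)))`. For small `lam` nearly all short packets are isolated, so the ratio is eventually at most
about `lmin / (lmax + lmin) = 1 / (ρ + 1)`, which is strictly below `1 / ((1 - ε) * ρ + 1)`. The
ratio never exceeds 1, so exceptional events of small probability cost only the additive `ε` in
expectation (`eventually_expectation_le`). -/

lemma len_nonneg (hmin : 0 < lmin) (hlt : lmin < lmax) (b : Bool) : 0 ≤ len lmin lmax b := by
  cases b <;> simp [len] <;> linarith

lemma IsRealization.finite_arrived (hA : IsRealization A) (t : ℝ) :
    {i | (A i).1 ≤ t}.Finite := by
  obtain ⟨N, hN⟩ := eventually_atTop.1 (hA.tendsto.eventually_gt_atTop t)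
  exact (finite_lt_nat N).subset fun i hi => by
    by_contra h
    exact absurd (hN i (not_lt.1 h)) (not_lt.2 hi)

lemma IsRealization.exists_arrivals (hA : IsRealization A) (t : ℝ) :
    ∃ n, ∀ i, (A i).1 ≤ t ↔ i < n := by
  classical
  have h : ∃ i, t < (A i).1 := (hA.tendsto.eventually_gt_atTop t).exists
  refine ⟨Nat.find h, fun i => ⟨fun hi => ?_, fun hi => not_lt.1 (Nat.find_min h hi)⟩⟩
  by_contra hn
  have h1 := hA.strictMono.monotone (not_lt.1 hn)
  have h2 := Nat.find_spec h
  linarith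

lemma isSchedule_empty (lmin lmax : ℝ) (A : Pattern) (Err : Set ℝ) (t : ℝ) (start : ℕ → ℝ) :
    IsSchedule lmin lmax A Err t ∅ start :=
  ⟨by simp, by simp, by simp, by simp⟩

lemma IsSchedule.mono {t t' : ℝ} {S : Finset ℕ} {start : ℕ → ℝ}
    (h : IsSchedule lmin lmax A Err t S start) (ht : t ≤ t') :
    IsSchedule lmin lmax A Err t' S start :=
  ⟨h.arrived, fun i hi => (h.completed i hi).trans ht, h.not_corrupted, h.disjoint⟩

/-- A packet that is not yet scheduled may be transmitted after all the others. -/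
lemma IsSchedule.insert {t s : ℝ} {S : Finset ℕ} {start : ℕ → ℝ}
    (h : IsSchedule lmin lmax A Err t S start) {i : ℕ} (hi : i ∉ S) (hts : t ≤ s)
    (hs : (A i).1 ≤ s) (hc : ¬ Corrupted Err s (len lmin lmax (A i).2))
    (hl : 0 ≤ len lmin lmax (A i).2) :
    IsSchedule lmin lmax A Err (s + len lmin lmax (A i).2) (insert i S)
      (Function.update start i s) := by
  have hne : ∀ j ∈ S, j ≠ i := fun j hj h => hi (h ▸ hj)
  have hst : ∀ j ∈ S, Function.update start i s j = start j := fun j hj =>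
    Function.update_of_ne (hne j hj) _ _
  refine ⟨?_, ?_, ?_, ?_⟩
  · intro j hj
    rcases Finset.mem_insert.1 hj with rfl | hj
    · simpa using hs
    · rw [hst j hj]; exact h.arrived j hj
  · intro j hj
    rcases Finset.mem_insert.1 hj with rfl | hj
    · simp
    · rw [hst j hj]; linarith [h.completed j hj]
  · intro j hj
    rcases Finset.mem_insert.1 hj with rfl | hj
    · simpa using hc
    · rw [hst j hj]; exact h.not_corrupted j hj
  · intro j hj k hk hjk
    rcases Finset.mem_insert.1 hj with hj | hj <;> rcases Finset.mem_insert.1 hk with hk | hk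
    · exact absurd (hj.trans hk.symm) hjk
    · right
      rw [hst k hk, hj, Function.update_self]; linarith [h.completed k hk]
    · left
      rw [hst j hj, hk, Function.update_self]; linarith [h.completed j hj]
    · rw [hst j hj, hst k hk]; exact h.disjoint j hj k hk hjk

lemma bddAbove_schedules (hmin : 0 < lmin) (hlt : lmin < lmax) (hA : IsRealization A)
    (Err : Set ℝ) (t : ℝ) :
    BddAbove {v | ∃ (S : Finset ℕ) (start : ℕ → ℝ), IsSchedule lmin lmax A Err t S start ∧
      v = ∑ i ∈ S, len lmin lmax (A i).2} := by
  refine ⟨∑ i ∈ (hA.finite_arrived t).toFinset, len lmin lmax (A i).2, ?_⟩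
  rintro v ⟨S, start, h, rfl⟩
  refine Finset.sum_le_sum_of_subset_of_nonneg (fun i hi => ?_)
    fun i _ _ => len_nonneg hmin hlt _
  have := len_nonneg hmin hlt (A i).2
  simp only [Finite.mem_toFinset, mem_ofPred_eq]
  linarith [h.arrived i hi, h.completed i hi]

lemma IsSchedule.le_optLength (hmin : 0 < lmin) (hlt : lmin < lmax) (hA : IsRealization A)
    {t : ℝ} {S : Finset ℕ} {start : ℕ → ℝ} (h : IsSchedule lmin lmax A Err t S start) :
    ∑ i ∈ S, len lmin lmax (A i).2 ≤ optLength lmin lmax A Err t :=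
  le_csSup (bddAbove_schedules hmin hlt hA Err t) ⟨S, start, h, rfl⟩

lemma sum_len_of_short {S : Finset ℕ} (hS : ∀ i ∈ S, (A i).2 = true) :
    ∑ i ∈ S, len lmin lmax (A i).2 = S.card * lmin := by
  rw [Finset.sum_congr rfl fun i hi => by rw [hS i hi, len, if_pos rfl], Finset.sum_const,
    nsmul_eq_mul]

/-- If there is always time later to transmit an `ℓmin` packet, `L_OPT` is unbounded. -/
lemma optLength_unbounded (hmin : 0 < lmin) (hlt : lmin < lmax) (hA : IsRealization A)
    (hfree : ∀ T, ∃ s ≥ T, ¬ Corrupted Err s lmin) (M : ℝ) :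
    ∃ t, M < optLength lmin lmax A Err t := by
  have key : ∀ n : ℕ, ∃ (t : ℝ) (S : Finset ℕ) (start : ℕ → ℝ),
      IsSchedule lmin lmax A Err t S start ∧ (∀ i ∈ S, (A i).2 = true) ∧ S.card = n := by
    intro n
    induction n with
    | zero => exact ⟨0, ∅, 0, isSchedule_empty _ _ _ _ _ _, by simp, rfl⟩
    | succ n ih =>
      obtain ⟨t, S, start, h, hS, hn⟩ := ih
      obtain ⟨i, hi, hiS⟩ := (hA.infinite_kind true).exists_notMem_finset S
      obtain ⟨s, hs, hc⟩ := hfree (max t (A i).1)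
      have hlen : len lmin lmax (A i).2 = lmin := by rw [show (A i).2 = true from hi]; rfl
      refine ⟨_, _, _, h.insert hiS ((le_max_left _ _).trans hs) ((le_max_right _ _).trans hs)
        (by rwa [hlen]) (len_nonneg hmin hlt _), ?_, by simp [hiS, hn]⟩
      intro j hj
      rcases Finset.mem_insert.1 hj with rfl | hj
      exacts [hi, hS j hj]
  obtain ⟨n, hn⟩ := exists_nat_gt (M / lmin)
  obtain ⟨t, S, start, h, hS, hcard⟩ := key n
  refine ⟨t, lt_of_lt_of_le ?_ (h.le_optLength hmin hlt hA)⟩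
  rw [sum_len_of_short hS, hcard]
  exact (div_lt_iff₀ hmin).1 hn

/-! ### The behaviour of SL when `ℓmax` packets are always corrupted -/

/-- SL has transmitted `ℓmin` packets only, which form a schedule. -/
structure OnlyShortSent (lmin lmax : ℝ) (A : Pattern) (Err : Set ℝ) (s : SLState) : Prop where
  time_nonneg : 0 ≤ s.time
  sentLong : s.sentLong = 0
  schedule : ∃ (S : Finset ℕ) (start : ℕ → ℝ), IsSchedule lmin lmax A Err s.time S start ∧
    (∀ i ∈ S, (A i).2 = true) ∧ S.card = s.sentShort

lemma OnlyShortSent.wait {s : SLState} (h : OnlyShortSent lmin lmax A Err s) {t : ℝ}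
    (ht : s.time ≤ t) : OnlyShortSent lmin lmax A Err { s with time := t } := by
  obtain ⟨S, start, hS, h1, h2⟩ := h.schedule
  exact ⟨h.time_nonneg.trans ht, h.sentLong, S, start, hS.mono ht, h1, h2⟩

lemma Corrupted.le_sInf {s l : ℝ} (h : Corrupted Err s l) : s ≤ sInf (Err ∩ Ioi s) := by
  obtain ⟨e, he, hs, -⟩ := h
  exact le_csInf ⟨e, he, hs⟩ fun x hx => hx.2.le

lemma finite_arrived_kind (hA : IsRealization A) (b : Bool) (t : ℝ) :
    {i | (A i).2 = b ∧ (A i).1 ≤ t}.Finite :=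
  (hA.finite_arrived t).subset fun _ h => h.2

lemma OnlyShortSent.step (hmin : 0 < lmin) (hlt : lmin < lmax) (hA : IsRealization A)
    (hErr : ∀ s, 0 ≤ s → ¬ Corrupted Err s lmax → ∃ i, (A i).2 = true ∧ (A i).1 = s)
    {s : SLState} (h : OnlyShortSent lmin lmax A Err s) :
    OnlyShortSent lmin lmax A Err (slStep lmin lmax A Err s) := by
  obtain ⟨S, start, hS, hshort, hcard⟩ := h.schedule
  unfold slStep
  split_ifs with h1 h2 h3 h4
  · exact h.wait h2.le_sInf
  -- The state of SL records only counts, so any arrived short packet outside `S` can stand for the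
  -- one being sent.
  · have hex : ∃ i, i ∈ {i | (A i).2 = true ∧ (A i).1 ≤ s.time} ∧ i ∉ (S : Set ℕ) := by
      apply exists_mem_notMem_of_ncard_lt_ncard
      · rw [ncard_coe_finset, hcard]
        exact h1
      · exact S.finite_toSet
    obtain ⟨i, ⟨hi, his⟩, hiS⟩ := hex
    have hlen : len lmin lmax (A i).2 = lmin := by rw [hi]; rfl
    have hins := hS.insert (s := s.time) (i := i) (by simpa using hiS) le_rfl his
      (by rwa [hlen]) (len_nonneg hmin hlt _)
    rw [hlen] at hins
    refine ⟨by have := h.time_nonneg; simp only; linarith, h.sentLong, _, _, hins, ?_, ?_⟩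
    · intro j hj
      rcases Finset.mem_insert.1 hj with rfl | hj
      exacts [hi, hshort j hj]
    · simp only [← hcard]
      exact Finset.card_insert_of_notMem (by simpa using hiS)
  · exact h.wait h4.le_sInf
  -- The short packet `i` arriving at this very instant cannot already have been transmitted, so it
  -- is pending and SL would not have chosen a long one.
  · exfalso
    obtain ⟨i, hi, his⟩ := hErr _ h.time_nonneg h4
    refine h1 ?_
    have hiS : i ∉ S := fun hiS => by
      have h5 := hS.arrived i hiS
      have h6 := hS.completed i hiS
      rw [hi, len, if_pos rfl] at h6
      linarith
    rw [← hcard, ← ncard_coe_finset]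
    refine ncard_lt_ncard ?_ (finite_arrived_kind hA true s.time)
    refine ssubset_of_subset_of_ne (fun j hj => ⟨hshort j hj, ?_⟩) fun heq => hiS ?_
    · have h5 := hS.arrived j hj
      have h6 := hS.completed j hj
      have := len_nonneg hmin hlt (A j).2
      linarith
    · have : i ∈ (S : Set ℕ) := heq ▸ ⟨hi, his.le⟩
      simpa using this
  · refine h.wait (le_csInf ?_ fun x hx => hx.2.le)
    obtain ⟨i, hi⟩ := (hA.tendsto.eventually_gt_atTop s.time).exists
    exact ⟨_, ⟨i, rfl⟩, hi⟩

lemma onlyShortSent_slState (hmin : 0 < lmin) (hlt : lmin < lmax) (hA : IsRealization A)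
    (hErr : ∀ s, 0 ≤ s → ¬ Corrupted Err s lmax → ∃ i, (A i).2 = true ∧ (A i).1 = s) (k : ℕ) :
    OnlyShortSent lmin lmax A Err (slState lmin lmax A Err k) := by
  induction k with
  | zero => exact ⟨le_rfl, rfl, ∅, 0, isSchedule_empty _ _ _ _ _ _, by simp, rfl⟩
  | succ k ih => exact ih.step hmin hlt hA hErr

lemma slLength_le_of_forall {t v : ℝ} (ht : 0 ≤ t)
    (h : ∀ k, (slState lmin lmax A Err k).time ≤ t →
      (slState lmin lmax A Err k).sentShort * lmin +
        (slState lmin lmax A Err k).sentLong * lmax ≤ v) :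
    slLength lmin lmax A Err t ≤ v := by
  refine csSup_le ⟨_, 0, ht, rfl⟩ ?_
  rintro _ ⟨k, hk, rfl⟩
  exact h k hk

/-- What SL sends is itself an offline schedule. This keeps the ratio at most 1 where no better
estimate is available. -/
lemma slLength_le_optLength (hmin : 0 < lmin) (hlt : lmin < lmax) (hA : IsRealization A)
    (hErr : ∀ s, 0 ≤ s → ¬ Corrupted Err s lmax → ∃ i, (A i).2 = true ∧ (A i).1 = s)
    {t : ℝ} (ht : 0 ≤ t) :
    slLength lmin lmax A Err t ≤ optLength lmin lmax A Err t := by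
  refine slLength_le_of_forall ht fun k hk => ?_
  obtain ⟨-, h0, S, start, hS, hshort, hcard⟩ := onlyShortSent_slState hmin hlt hA hErr k
  have := (hS.mono hk).le_optLength hmin hlt hA
  rw [sum_len_of_short hshort, hcard] at this
  simpa [h0] using this

lemma slLength_le_arrived (hmin : 0 < lmin) (hlt : lmin < lmax) (hA : IsRealization A)
    (hErr : ∀ s, 0 ≤ s → ¬ Corrupted Err s lmax → ∃ i, (A i).2 = true ∧ (A i).1 = s)
    {t : ℝ} (ht : 0 ≤ t) :
    slLength lmin lmax A Err t ≤ arrived A true t * lmin := by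
  refine slLength_le_of_forall ht fun k hk => ?_
  obtain ⟨-, h0, S, start, hS, hshort, hcard⟩ := onlyShortSent_slState hmin hlt hA hErr k
  rw [h0, Nat.cast_zero, zero_mul, add_zero, ← hcard]
  refine mul_le_mul_of_nonneg_right ?_ hmin.le
  rw [← ncard_coe_finset]
  refine Nat.cast_le.2 (ncard_le_ncard (fun j hj => ⟨hshort j hj, ?_⟩)
    (finite_arrived_kind hA true t))
  have h5 := hS.arrived j hj
  have h6 := hS.completed j hj
  have := len_nonneg hmin hlt (A j).2
  linarith

/-! ### The adversary -/

/-- The time between the arrival of packet `i` and the previous arrival (or time `0`). -/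
def gap (A : Pattern) (i : ℕ) : ℝ := (A i).1 - if i = 0 then 0 else (A (i - 1)).1

/-- Packet `i` has length `ℓmin` and arrives more than `c` after the previous packet. -/
def IsolatedShort (c : ℝ) (A : Pattern) (i : ℕ) : Prop := (A i).2 = true ∧ c < gap A i

/-- The errors at the borders of the two slots, of lengths `ℓmax` and `ℓmin`, that begin with the
arrival of each isolated `ℓmin` packet, and errors at the multiples of `ℓmin` outside these
slots. -/
def slotErrors (lmin lmax : ℝ) (A : Pattern) : Set ℝ :=
  {x | (∃ i, IsolatedShort (lmax + lmin) A i ∧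
      (x = (A i).1 ∨ x = (A i).1 + lmax ∨ x = (A i).1 + lmax + lmin)) ∨
    ((∃ n : ℕ, x = n * lmin) ∧
      ∀ i, IsolatedShort (lmax + lmin) A i → ¬ ((A i).1 < x ∧ x < (A i).1 + lmax + lmin))}

/-- The arrival just before `j` is no earlier than that of `i`. With `c = lmax + lmin`, the slots of
different isolated packets therefore never overlap. -/
lemma IsolatedShort.lt_of_lt (hA : IsRealization A) {c : ℝ} {i j : ℕ} (hij : i < j)
    (hj : IsolatedShort c A j) : (A i).1 + c < (A j).1 := by
  have h1 := hA.strictMono.monotone (Nat.le_sub_one_of_lt hij)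
  have h2 := hj.2
  rw [gap, if_neg (by omega)] at h2
  linarith

lemma IsolatedShort.disjoint_slots (hA : IsRealization A) (hmin : 0 < lmin) (hlt : lmin < lmax)
    {i : ℕ} (hi : IsolatedShort (lmax + lmin) A i) {x : ℝ} (hx : x ∈ slotErrors lmin lmax A)
    (h1 : (A i).1 < x) (h2 : x < (A i).1 + lmax + lmin) : x = (A i).1 + lmax := by
  rcases hx with ⟨j, hj, hx⟩ | ⟨-, hx⟩
  · rcases lt_trichotomy i j with h | rfl | h
    · have := hj.lt_of_lt hA h
      rcases hx with rfl | rfl | rfl <;> linarith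
    · rcases hx with rfl | rfl | rfl <;> linarith
    · have := hi.lt_of_lt hA h
      rcases hx with rfl | rfl | rfl <;> linarith
  · exact absurd ⟨h1, h2⟩ (hx i hi)

lemma IsolatedShort.not_corrupted_long (hA : IsRealization A) (hmin : 0 < lmin)
    (hlt : lmin < lmax) {i : ℕ} (hi : IsolatedShort (lmax + lmin) A i) :
    ¬ Corrupted (slotErrors lmin lmax A) (A i).1 lmax := by
  rintro ⟨x, hx, h1, h2⟩
  linarith [hi.disjoint_slots hA hmin hlt hx h1 (by linarith)]

lemma IsolatedShort.not_corrupted_short (hA : IsRealization A) (hmin : 0 < lmin)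
    (hlt : lmin < lmax) {i : ℕ} (hi : IsolatedShort (lmax + lmin) A i) :
    ¬ Corrupted (slotErrors lmin lmax A) ((A i).1 + lmax) lmin := by
  rintro ⟨x, hx, h1, h2⟩
  linarith [hi.disjoint_slots hA hmin hlt hx (by linarith) h2]

/-- Past its opening instant, a pair of slots has a border less than `lmax` ahead; outside the
slots, the next multiple of `lmin` or the opening of a new slot is that close. -/
lemma exists_short_of_not_corrupted (hmin : 0 < lmin) (hlt : lmin < lmax) (s : ℝ) (hs : 0 ≤ s)
    (h : ¬ Corrupted (slotErrors lmin lmax A) s lmax) :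
    ∃ i, (A i).2 = true ∧ (A i).1 = s := by
  by_contra! hne
  by_cases hw : ∃ i, IsolatedShort (lmax + lmin) A i ∧ (A i).1 ≤ s ∧ s < (A i).1 + lmax + lmin
  · obtain ⟨i, hi, h1, h2⟩ := hw
    have h3 := lt_of_le_of_ne h1 (hne i hi.1)
    rcases lt_or_ge s ((A i).1 + lmax) with h4 | h4
    · exact h ⟨_, .inl ⟨i, hi, .inr (.inl rfl)⟩, h4, by linarith⟩
    · exact h ⟨_, .inl ⟨i, hi, .inr (.inr rfl)⟩, h2, by linarith⟩
  · push Not at hw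
    -- The first multiple of `lmin` strictly after `s`; it lies at most `lmin`, hence less than
    -- `lmax`, ahead.
    set n := ⌊s / lmin⌋₊ + 1 with hn
    have h1 : s < n * lmin := by
      rw [← div_lt_iff₀ hmin, hn]; push_cast; exact Nat.lt_floor_add_one _
    have h2 : (n : ℝ) * lmin ≤ s + lmin := by
      have := Nat.floor_le (div_nonneg hs hmin.le)
      rw [le_div_iff₀ hmin] at this
      rw [hn]; push_cast; linarith
    by_cases hx : (n : ℝ) * lmin ∈ slotErrors lmin lmax A
    · exact h ⟨_, hx, h1, by linarith⟩
    · have : ∃ i, IsolatedShort (lmax + lmin) A i ∧ (A i).1 < n * lmin ∧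
          n * lmin < (A i).1 + lmax + lmin := by
        by_contra! h'
        exact hx (.inr ⟨⟨n, rfl⟩, fun i hi h3 => absurd h3.2 (not_lt.2 (h' i hi h3.1))⟩)
      obtain ⟨i, hi, h3, h4⟩ := this
      -- A slot pair suppressing this multiple must open after `s`, since any opened earlier is over
      -- by `s`; the error at its opening does the damage instead.
      refine h ⟨_, .inl ⟨i, hi, .inl rfl⟩, ?_, by linarith⟩
      by_contra! h5
      linarith [hw i hi h5]

/-! ### Admissibility of the adversary -/

lemma measurable_gap (i : ℕ) : Measurable fun A : Pattern => gap A i := by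
  unfold gap
  split_ifs <;> fun_prop

lemma measurableSet_isolatedShort (c : ℝ) (i : ℕ) :
    MeasurableSet {A : Pattern | IsolatedShort c A i} := by
  refine MeasurableSet.inter ?_ (measurableSet_lt measurable_const (measurable_gap i))
  have : Measurable fun A : Pattern => (A i).2 := by fun_prop
  exact this (measurableSet_singleton true)

lemma measurableSet_slotErrors (lmin lmax : ℝ) :
    MeasurableSet {x : ℝ × Pattern | x.1 ∈ slotErrors lmin lmax x.2} := by
  have hI (i : ℕ) : MeasurableSet {x : ℝ × Pattern | IsolatedShort (lmax + lmin) x.2 i} :=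
    measurable_snd (measurableSet_isolatedShort _ i)
  have ha (i : ℕ) : Measurable fun x : ℝ × Pattern => (x.2 i).1 := by fun_prop
  refine MeasurableSet.union (s₁ := {x : ℝ × Pattern | _}) (s₂ := {x : ℝ × Pattern | _}) ?_ ?_
  · simp only [ofPred_exists]
    refine MeasurableSet.iUnion fun i => (hI i).inter ?_
    exact (measurableSet_eq_fun measurable_fst (ha i)).union
      ((measurableSet_eq_fun measurable_fst ((ha i).add_const _)).union
        (measurableSet_eq_fun measurable_fst (((ha i).add_const _).add_const _)))
  · refine MeasurableSet.inter (s₁ := {x : ℝ × Pattern | _}) (s₂ := {x : ℝ × Pattern | _}) ?_ ?_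
    · simp only [ofPred_exists]
      exact MeasurableSet.iUnion fun n => measurableSet_eq_fun measurable_fst measurable_const
    · simp only [ofPred_forall]
      refine MeasurableSet.iInter fun i => (hI i).imp (MeasurableSet.compl ?_)
      exact (measurableSet_lt (ha i) measurable_fst).inter
        (measurableSet_lt measurable_fst (((ha i).add_const _).add_const _))

lemma finite_slotErrors (hmin : 0 < lmin) (hlt : lmin < lmax) (hA : IsRealization A) (t : ℝ) :
    (slotErrors lmin lmax A ∩ Icc 0 t).Finite := by
  have hF := hA.finite_arrived t
  have hG : {n : ℕ | (n : ℝ) * lmin ≤ t}.Finite :=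
    (finite_le_nat ⌊t / lmin⌋₊).subset fun n hn => Nat.le_floor ((le_div_iff₀ hmin).2 hn)
  refine ((((hF.image fun i => (A i).1).union (hF.image fun i => (A i).1 + lmax)).union
    (hF.image fun i => (A i).1 + lmax + lmin)).union
      (hG.image fun n : ℕ => (n : ℝ) * lmin)).subset ?_
  rintro x ⟨⟨i, -, hx⟩ | ⟨⟨n, rfl⟩, -⟩, h0, ht⟩
  · have hi : (A i).1 ≤ t := by rcases hx with rfl | rfl | rfl <;> linarith
    rcases hx with rfl | rfl | rfl
    · exact .inl (.inl (.inl ⟨i, hi, rfl⟩))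
    · exact .inl (.inl (.inr ⟨i, hi, rfl⟩))
    · exact .inl (.inr ⟨i, hi, rfl⟩)
  · exact .inr ⟨n, ht, rfl⟩

lemma AgreeUpTo.symm {t : ℝ} {A A' : Pattern} (h : AgreeUpTo t A A') : AgreeUpTo t A' A :=
  fun i hi => (h i hi.symm).symm

/-- Isolation of packet `i` is decided by packets `i` and `i - 1`, both of which have arrived by
time `t`. -/
lemma AgreeUpTo.isolatedShort {t c : ℝ} {A' : Pattern} (hA : IsRealization A)
    (h : AgreeUpTo t A A') {i : ℕ} (hi : (A i).1 ≤ t) (hI : IsolatedShort c A i) :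
    IsolatedShort c A' i := by
  have h1 : A i = A' i := h i (.inl hi)
  have h2 : A (i - 1) = A' (i - 1) :=
    h _ (.inl ((hA.strictMono.monotone (Nat.sub_le i 1)).trans hi))
  unfold IsolatedShort gap at *
  rwa [← h1, ← h2]

/-- No border precedes the arrival that causes it, and a multiple of `lmin` is suppressed only by a
slot pair that is already open. Equality follows by symmetry. -/
lemma AgreeUpTo.slotErrors_subset (hmin : 0 < lmin) (hlt : lmin < lmax) {t : ℝ} {A' : Pattern}
    (hA : IsRealization A) (hA' : IsRealization A') (h : AgreeUpTo t A A') :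
    slotErrors lmin lmax A ∩ Iic t ⊆ slotErrors lmin lmax A' ∩ Iic t := by
  rintro x ⟨⟨i, hI, hx⟩ | ⟨hn, hx⟩, hxt⟩
  · have hxt' : x ≤ t := hxt
    have hi : (A i).1 ≤ t := by rcases hx with rfl | rfl | rfl <;> linarith
    refine ⟨.inl ⟨i, h.isolatedShort hA hi hI, ?_⟩, hxt⟩
    rwa [← h i (.inl hi)]
  · refine ⟨.inr ⟨hn, fun i hI hi => ?_⟩, hxt⟩
    have hxt' : x ≤ t := hxt
    have hit : (A' i).1 ≤ t := by linarith [hi.1]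
    refine hx i (h.symm.isolatedShort hA' hit hI) ?_
    rwa [h i (.inr hit)]

/-- Realizations with only finitely many isolated packets must be covered too: beyond their last
slot, the errors are multiples of `lmin` and a short packet fits between two consecutive ones. -/
lemma exists_not_corrupted_slotErrors (hmin : 0 < lmin) (hlt : lmin < lmax)
    (hA : IsRealization A) (T : ℝ) :
    ∃ s ≥ T, ¬ Corrupted (slotErrors lmin lmax A) s lmin := by
  by_cases hI : ∃ i, IsolatedShort (lmax + lmin) A i ∧ T ≤ (A i).1
  · obtain ⟨i, hi, hT⟩ := hI
    exact ⟨_, by linarith, hi.not_corrupted_short hA hmin hlt⟩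
  · push Not at hI
    obtain ⟨n, hn⟩ := exists_nat_gt ((T + lmax + lmin) / lmin)
    rw [div_lt_iff₀ hmin] at hn
    refine ⟨n * lmin, by linarith, ?_⟩
    rintro ⟨x, ⟨i, hi, hx⟩ | ⟨⟨m, rfl⟩, -⟩, h1, h2⟩
    · have := hI i hi
      rcases hx with rfl | rfl | rfl <;> linarith
    · have h3 : (n : ℝ) < m := lt_of_mul_lt_mul_right h1 hmin.le
      have h4 : (m : ℝ) < n + 1 := lt_of_mul_lt_mul_right (by linarith) hmin.le
      norm_cast at h3 h4
      omega

lemma isErrorFunction_slotErrors (hmin : 0 < lmin) (hlt : lmin < lmax) :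
    IsErrorFunction lmin lmax (slotErrors lmin lmax) where
  measurable := measurableSet_slotErrors lmin lmax
  locallyFinite _ hA t := finite_slotErrors hmin hlt hA t
  nonanticipating _ _ hA hA' _ h :=
    (h.slotErrors_subset hmin hlt hA hA').antisymm (h.symm.slotErrors_subset hmin hlt hA' hA)
  nontrivial _ hA M :=
    optLength_unbounded hmin hlt hA (exists_not_corrupted_slotErrors hmin hlt hA) M

/-! ### A lower bound for the optimal schedule -/

/-- The number of `ℓmin` packets among the first `n` packets. -/
def countShort (A : Pattern) (n : ℕ) : ℕ := Nat.count (fun i => (A i).2 = true) n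

open Classical in
/-- The number of isolated `ℓmin` packets among the first `n` packets. -/
def countIsolated (c : ℝ) (A : Pattern) (n : ℕ) : ℕ := Nat.count (IsolatedShort c A) n

lemma countIsolated_le_countShort (c : ℝ) (A : Pattern) (n : ℕ) :
    countIsolated c A n ≤ countShort A n := by
  classical exact Nat.count_mono_left fun _ _ h => h.1

lemma card_long_add_countShort (A : Pattern) (n : ℕ) :
    ((Finset.range n).filter fun i => (A i).2 = false).card + countShort A n = n := by
  rw [countShort, Nat.count_eq_card_filter_range]
  have := Finset.card_filter_add_card_filter_not (s := Finset.range n) fun i => (A i).2 = true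
  simp only [Bool.not_eq_true, Finset.card_range] at this
  omega

/-- From packet `N` on, a schedule transmits in the two slots of each isolated `ℓmin` packet some
`ℓmax` packet and the isolated packet itself. -/
lemma exists_slot_schedule (hmin : 0 < lmin) (hlt : lmin < lmax) (hA : IsRealization A) {N : ℕ}
    (hN : ∀ j ≥ N, 2 * countShort A j ≤ j) (d : ℕ) :
    ∃ (T : ℝ) (S : Finset ℕ) (start : ℕ → ℝ),
      IsSchedule lmin lmax A (slotErrors lmin lmax A) T S start ∧ S ⊆ Finset.range (N + d) ∧
      (∀ j ≥ N + d, IsolatedShort (lmax + lmin) A j → T ≤ (A j).1) ∧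
      (S.filter fun i => (A i).2 = false).card + countIsolated (lmax + lmin) A N =
        countIsolated (lmax + lmin) A (N + d) ∧
      ∑ i ∈ S, len lmin lmax (A i).2 =
        (lmax + lmin) * (countIsolated (lmax + lmin) A (N + d) -
          countIsolated (lmax + lmin) A N) := by
  classical
  induction d with
  | zero =>
    exact ⟨0, ∅, 0, isSchedule_empty _ _ _ _ _ _, by simp, fun j _ _ => (hA.pos j).le, by simp,
      by simp⟩
  | succ d ih =>
    obtain ⟨T, S, start, hS, hsub, hT, hcard, hsum⟩ := ih
    have hcount : countIsolated (lmax + lmin) A (N + (d + 1)) =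
        countIsolated (lmax + lmin) A (N + d) +
          if IsolatedShort (lmax + lmin) A (N + d) then 1 else 0 := by
      rw [countIsolated, ← add_assoc, Nat.count_succ, countIsolated]
    have hsub' : S ⊆ Finset.range (N + (d + 1)) :=
      hsub.trans (Finset.range_subset_range.2 (by omega))
    by_cases hI : IsolatedShort (lmax + lmin) A (N + d)
    · rw [if_pos hI] at hcount
      -- Long packets used so far number at most the isolated, hence the short, packets among the
      -- first `N + d`. As packet `N + d` is itself short, `hN` at `N + d + 1` leaves an unused long
      -- packet that has already arrived.
      have hlong : (S.filter fun i => (A i).2 = false).card <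
          ((Finset.range (N + d)).filter fun i => (A i).2 = false).card := by
        have h1 := card_long_add_countShort A (N + d)
        have h2 := hN (N + d + 1) (by omega)
        have h3 := countIsolated_le_countShort (lmax + lmin) A (N + d)
        rw [countShort, Nat.count_succ, if_pos hI.1, ← countShort] at h2
        omega
      obtain ⟨l, hl, hlS⟩ := Finset.exists_mem_notMem_of_card_lt_card hlong
      obtain ⟨hlN, hlong'⟩ := Finset.mem_filter.1 hl
      rw [Finset.mem_range] at hlN
      have hlS' : l ∉ S := fun h => hlS (Finset.mem_filter.2 ⟨h, hlong'⟩)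
      have hlenl : len lmin lmax (A l).2 = lmax := by rw [hlong']; rfl
      have hleni : len lmin lmax (A (N + d)).2 = lmin := by rw [hI.1]; rfl
      have hS1 := hS.insert hlS' (hT _ le_rfl hI) (hA.strictMono.monotone hlN.le)
        (by rw [hlenl]; exact hI.not_corrupted_long hA hmin hlt) (len_nonneg hmin hlt _)
      rw [hlenl] at hS1
      have hiS : N + d ∉ S := fun h => absurd (Finset.mem_range.1 (hsub h)) (by omega)
      have hiS1 : N + d ∉ insert l S := by
        simp only [Finset.mem_insert, not_or]
        exact ⟨by omega, hiS⟩
      have hS2 := hS1.insert hiS1 le_rfl (by linarith)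
        (by rw [hleni]; exact hI.not_corrupted_short hA hmin hlt) (len_nonneg hmin hlt _)
      rw [hleni] at hS2
      refine ⟨_, _, _, hS2, ?_, ?_, ?_, ?_⟩
      · intro j hj
        simp only [Finset.mem_insert] at hj
        rcases hj with rfl | rfl | hj
        · simp
        · simp only [Finset.mem_range]; omega
        · exact hsub' hj
      -- The next isolated packet arrives only after both slots are over.
      · intro j hj hjI
        linarith [hjI.lt_of_lt hA (show N + d < j by omega)]
      · rw [Finset.filter_insert, if_neg (by simp [hI.1]), Finset.filter_insert, if_pos hlong',
          Finset.card_insert_of_notMem hlS]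
        omega
      · rw [Finset.sum_insert hiS1, Finset.sum_insert hlS', hsum, hlenl, hleni, hcount]
        push_cast
        ring
    · rw [if_neg hI, add_zero] at hcount
      exact ⟨T, S, start, hS, hsub', fun j hj => hT j (by omega), by omega, by rw [hsum, hcount]⟩

lemma exists_last_of_count_pos {p : ℕ → Prop} [DecidablePred p] {n : ℕ}
    (hn : 0 < Nat.count p n) : ∃ j < n, p j ∧ Nat.count p j + 1 = Nat.count p n := by
  induction n with
  | zero => simp at hn
  | succ n ih =>
    rw [Nat.count_succ] at hn ⊢
    split_ifs at hn ⊢ with hp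
    · exact ⟨n, n.lt_succ_self, hp, rfl⟩
    · obtain ⟨j, hj, h⟩ := ih hn
      exact ⟨j, hj.trans n.lt_succ_self, h⟩

/-- The loss `N + 1` has two sources: isolated packets among the first `N`, which are not served,
and the last isolated packet, whose slots may extend past `t`. -/
lemma optLength_slotErrors_ge (hmin : 0 < lmin) (hlt : lmin < lmax) (hA : IsRealization A)
    {N : ℕ} (hN : ∀ j ≥ N, 2 * countShort A j ≤ j) {n : ℕ} {t : ℝ}
    (hn : ∀ i < n, (A i).1 ≤ t) :
    (lmax + lmin) * (countIsolated (lmax + lmin) A n - (N + 1)) ≤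
      optLength lmin lmax A (slotErrors lmin lmax A) t := by
  classical
  have hNN : countIsolated (lmax + lmin) A N ≤ N := Nat.count_le _
  rcases Nat.lt_or_ge (countIsolated (lmax + lmin) A n) (N + 1) with h | h
  · have h0 := (isSchedule_empty lmin lmax A (slotErrors lmin lmax A) t 0).le_optLength
      hmin hlt hA
    rw [Finset.sum_empty] at h0
    refine le_trans (mul_nonpos_of_nonneg_of_nonpos (by linarith) ?_) h0
    have : (countIsolated (lmax + lmin) A n : ℝ) ≤ N := by exact_mod_cast Nat.lt_succ_iff.1 h
    linarith
  · obtain ⟨j, hjn, hj, hjc⟩ : ∃ j < n, IsolatedShort (lmax + lmin) A j ∧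
        countIsolated (lmax + lmin) A j + 1 = countIsolated (lmax + lmin) A n := by
      exact exists_last_of_count_pos (by rw [countIsolated] at h; omega)
    have hNj : N ≤ j := by
      by_contra! hlt'
      have : countIsolated (lmax + lmin) A j ≤ j := Nat.count_le _
      omega
    obtain ⟨T, S, start, hS, -, hT, -, hsum⟩ :=
      exists_slot_schedule hmin hlt hA hN (j - N)
    rw [Nat.add_sub_cancel' hNj] at hsum hT
    have h1 := (hS.mono ((hT j le_rfl hj).trans (hn j hjn))).le_optLength hmin hlt hA
    rw [hsum] at h1
    refine le_trans (mul_le_mul_of_nonneg_left ?_ (by linarith)) h1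
    have h2 : (countIsolated (lmax + lmin) A N : ℝ) ≤ N := by exact_mod_cast hNN
    rw [← hjc]
    push_cast
    linarith

/-! ### Comparison of SL with the optimum -/

lemma arrived_eq_countShort {n : ℕ} {t : ℝ} (hn : ∀ i, (A i).1 ≤ t ↔ i < n) :
    arrived A true t = countShort A n := by
  rw [arrived, countShort, Nat.count_eq_card_filter_range, ← ncard_coe_finset]
  congr 1
  ext i
  simp [hn, and_comm]

lemma throughputBy_slotErrors_le_one (hmin : 0 < lmin) (hlt : lmin < lmax)
    (hA : IsRealization A) {t : ℝ} (ht : 0 ≤ t) :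
    throughputBy lmin lmax (slLength lmin lmax) A (slotErrors lmin lmax A) t ≤ 1 := by
  unfold throughputBy
  split_ifs
  · exact le_rfl
  · refine div_le_one_of_le₀
      (slLength_le_optLength hmin hlt hA (exists_short_of_not_corrupted hmin hlt) ht) ?_
    simpa using (isSchedule_empty lmin lmax A (slotErrors lmin lmax A) t 0).le_optLength
      hmin hlt hA

/-- The surplus `κ * j` grows linearly and, once `M` packets have arrived, outweighs the constant
loss `(lmax + lmin) * (N + 1)`. -/
lemma throughputBy_slotErrors_le (hmin : 0 < lmin) (hlt : lmin < lmax) (hA : IsRealization A)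
    {D κ : ℝ} (hD : 0 < D) (hκ : 0 < κ) {N M : ℕ} (hNM : N ≤ M)
    (hM : (lmax + lmin) * (N + 1) < κ * M)
    (hN : ∀ j ≥ N, 2 * countShort A j ≤ j ∧
      D * lmin * countShort A j + κ * j ≤ (lmax + lmin) * countIsolated (lmax + lmin) A j)
    {t : ℝ} (ht : 0 ≤ t) (htM : (A M).1 ≤ t) :
    throughputBy lmin lmax (slLength lmin lmax) A (slotErrors lmin lmax A) t ≤ 1 / D := by
  obtain ⟨n, hn⟩ := hA.exists_arrivals t
  have hMn : M ≤ n := ((hn M).1 htM).le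
  have h1 := slLength_le_arrived hmin hlt hA (exists_short_of_not_corrupted hmin hlt) ht
  rw [arrived_eq_countShort hn] at h1
  have h2 := optLength_slotErrors_ge hmin hlt hA (fun j hj => (hN j hj).1)
    fun i hi => (hn i).2 hi
  have h3 := (hN n (hNM.trans hMn)).2
  have h4 : κ * (M : ℝ) ≤ κ * n := by gcongr
  have h5 : D * slLength lmin lmax A (slotErrors lmin lmax A) t <
      optLength lmin lmax A (slotErrors lmin lmax A) t := by
    have := mul_le_mul_of_nonneg_left h1 hD.le
    linarith
  have h6 : 0 < optLength lmin lmax A (slotErrors lmin lmax A) t := by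
    have : 0 ≤ D * lmin * countShort A n := by positivity
    linarith
  rw [throughputBy, if_neg fun h => h6.ne' h.2, div_le_div_iff₀ h6 hD]
  linarith

/-! ### Almost sure properties of the arrival process -/

lemma gap_ofGaps (g : ℕ → ℝ × Bool) (i : ℕ) : gap (ofGaps g) i = (g i).1 := by
  rcases i with _ | i
  · simp [gap, ofGaps]
  · simp [gap, ofGaps, Finset.sum_range_succ _ (i + 1)]

lemma ae_arrivalLaw {lam p q : ℝ} {P : Pattern → Prop} (hP : MeasurableSet {A | P A})
    (h : ∀ᵐ g ∂(Measure.infinitePi fun _ : ℕ => (expMeasure lam).prod (kindLaw p q)),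
      P (ofGaps g)) : ∀ᵐ A ∂arrivalLaw lam p q, P A :=
  (ae_map_iff measurable_ofGaps.aemeasurable hP).2 h

lemma measurable_count {u : Pattern → ℕ → Prop} [∀ A, DecidablePred (u A)]
    (hu : ∀ i, MeasurableSet {A | u A i}) (n : ℕ) : Measurable fun A => Nat.count (u A) n := by
  induction n with
  | zero => simp
  | succ n ih =>
    simp only [Nat.count_succ]
    exact ih.add (Measurable.ite (hu n) measurable_const measurable_const)

lemma measurable_gap_kind (i : ℕ) : Measurable fun A : Pattern => (gap A i, (A i).2) :=
  (measurable_gap i).prodMk (by fun_prop)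

/-- The strong law of large numbers for the number of packets whose kind and time since the
previous arrival satisfy a given condition. -/
lemma ae_tendsto_count {lam p q : ℝ} (hlam : 0 < lam) (hp : 0 < p) (hq : 0 < q)
    (hpq : p + q = 1) (u : ℝ × Bool → Prop) [DecidablePred u] (hu : MeasurableSet {x | u x}) :
    ∀ᵐ A ∂arrivalLaw lam p q,
      Tendsto (fun n => (Nat.count (fun i => u (gap A i, (A i).2)) n : ℝ) / n) atTop
        (nhds (((expMeasure lam).prod (kindLaw p q)).real {x | u x})) := by
  have := isProbabilityMeasure_expMeasure hlam
  have := isProbabilityMeasure_kindLaw hp hq hpq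
  set ν := (expMeasure lam).prod (kindLaw p q) with hν
  refine ae_arrivalLaw (measurableSet_tendsto _ fun n => ?_) ?_
  · exact ((measurable_from_top (f := fun n : ℕ => (n : ℝ))).comp
      (measurable_count (fun i => measurable_gap_kind i hu) n)).div_const _
  · set f : ℝ × Bool → ℝ := {x | u x}.indicator 1 with hf
    have hfm : Measurable f := measurable_one.indicator hu
    have hmp := fun i : ℕ => measurePreserving_eval_infinitePi (fun _ : ℕ => ν) i
    have hid (i : ℕ) : IdentDistrib (fun g : ℕ → ℝ × Bool => f (g i)) f
        (Measure.infinitePi fun _ : ℕ => ν) ν :=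
      ⟨(hfm.comp (measurable_pi_apply i)).aemeasurable, hfm.aemeasurable, by
        exact (Measure.map_map hfm (measurable_pi_apply i)).symm.trans
          (congrArg (Measure.map f) (hmp i).map_eq)⟩
    have hfint : Integrable f ν := (integrable_const 1).indicator hu
    have hslln := strong_law_ae_real (μ := Measure.infinitePi fun _ : ℕ => ν)
      (fun i g => f (g i)) ((hid 0).integrable_iff.2 hfint)
      (fun i j hij => (iIndepFun_infinitePi (X := fun _ => f) fun _ => hfm).indepFun hij)
      fun i => (hid i).trans (hid 0).symm
    have hmean : (∫ g, f (g 0) ∂(Measure.infinitePi fun _ : ℕ => ν)) = ν.real {x | u x} := by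
      rw [(hid 0).integral_eq, hf, integral_indicator_one hu]
    filter_upwards [hslln] with g hg
    rw [hmean] at hg
    refine hg.congr fun n => ?_
    congr 1
    rw [Nat.count_eq_card_filter_range, Finset.natCast_card_filter]
    refine Finset.sum_congr rfl fun i _ => ?_
    rw [gap_ofGaps]
    simp [hf, indicator_apply, ofGaps]

/-- A finite set would have a bounded count and hence frequency 0. -/
lemma infinite_of_tendsto_count {u : ℕ → Prop} [DecidablePred u] {r : ℝ} (hr : 0 < r)
    (h : Tendsto (fun n => (Nat.count u n : ℝ) / n) atTop (nhds r)) : {i | u i}.Infinite := by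
  intro hfin
  have h0 : Tendsto (fun n : ℕ => (hfin.toFinset.card : ℝ) / n) atTop (nhds 0) :=
    tendsto_const_div_atTop_nhds_zero_nat _
  refine absurd (le_of_tendsto_of_tendsto' h h0 fun n => ?_) (not_le.2 hr)
  gcongr
  rw [Nat.count_eq_card_filter_range]
  refine Finset.card_le_card fun i hi => ?_
  simpa using (Finset.mem_filter.1 hi).2

lemma kindLaw_real_true {p q : ℝ} (hp : 0 < p) : (kindLaw p q).real {true} = p := by
  simp [kindLaw, measureReal_def, hp.le]

lemma kindLaw_real_false {p q : ℝ} (hq : 0 < q) : (kindLaw p q).real {false} = q := by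
  simp [kindLaw, measureReal_def, hq.le]

lemma expMeasure_real_Ioi {lam c : ℝ} (hlam : 0 < lam) (hc : 0 ≤ c) :
    (expMeasure lam).real (Ioi c) = Real.exp (-(lam * c)) := by
  have := isProbabilityMeasure_expMeasure hlam
  rw [← compl_Iic, probReal_compl_eq_one_sub measurableSet_Iic, ← cdf_eq_real,
    cdf_expMeasure_eq hlam, if_pos hc, sub_sub_cancel]

lemma prod_real_kind {lam p q : ℝ} (hlam : 0 < lam) (b : Bool) :
    ((expMeasure lam).prod (kindLaw p q)).real {x | x.2 = b} = (kindLaw p q).real {b} := by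
  have := isProbabilityMeasure_expMeasure hlam
  have h : {x : ℝ × Bool | x.2 = b} = univ ×ˢ {b} := by ext; simp
  rw [h, measureReal_prod_prod, probReal_univ, one_mul]

lemma ae_gap_pos {lam p q : ℝ} (hlam : 0 < lam) (hp : 0 < p) (hq : 0 < q) (hpq : p + q = 1) :
    ∀ᵐ A ∂arrivalLaw lam p q, ∀ i, 0 < gap A i := by
  have := isProbabilityMeasure_expMeasure hlam
  have := isProbabilityMeasure_kindLaw hp hq hpq
  refine ae_all_iff.2 fun i =>
    ae_arrivalLaw (measurableSet_lt measurable_const (measurable_gap i)) ?_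
  have hexp : ∀ᵐ x ∂expMeasure lam, 0 < x := by
    rw [ae_iff]
    simp only [not_lt]
    change expMeasure lam (Iic 0) = 0
    rw [← ofReal_cdf, cdf_expMeasure_eq hlam]
    simp
  have hν : ∀ᵐ x ∂(expMeasure lam).prod (kindLaw p q), 0 < x.1 :=
    Measure.quasiMeasurePreserving_fst.ae hexp
  filter_upwards [(measurePreserving_eval_infinitePi
    (fun _ : ℕ => (expMeasure lam).prod (kindLaw p q)) i).quasiMeasurePreserving.ae hν] with g hg
  rw [gap_ofGaps]
  exact hg

lemma fst_succ (A : Pattern) (i : ℕ) : (A (i + 1)).1 = (A i).1 + gap A (i + 1) := by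
  simp [gap]

lemma ae_isRealization {lam p q : ℝ} (hlam : 0 < lam) (hp : 0 < p) (hq : 0 < q)
    (hpq : p + q = 1) : ∀ᵐ A ∂arrivalLaw lam p q, IsRealization A := by
  classical
  have := isProbabilityMeasure_kindLaw hp hq hpq
  have hm : MeasurableSet {x : ℝ × Bool | 1 < x.1} := measurableSet_lt measurable_const
    measurable_fst
  have hk (b : Bool) : MeasurableSet {x : ℝ × Bool | x.2 = b} :=
    measurable_snd (measurableSet_singleton b)
  filter_upwards [ae_gap_pos hlam hp hq hpq,
    ae_tendsto_count hlam hp hq hpq (fun x => 1 < x.1) hm,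
    ae_tendsto_count hlam hp hq hpq (fun x => x.2 = true) (hk true),
    ae_tendsto_count hlam hp hq hpq (fun x => x.2 = false) (hk false)] with A hgap h1 ht hf
  rw [prod_real_kind hlam, kindLaw_real_true hp] at ht
  rw [prod_real_kind hlam, kindLaw_real_false hq] at hf
  -- Infinitely many gaps above 1 force the arrival times to infinity.
  have hlong : {i | 1 < gap A i}.Infinite := by
    refine infinite_of_tendsto_count ?_ h1
    have h : {x : ℝ × Bool | 1 < x.1} = Ioi 1 ×ˢ univ := by ext; simp
    rw [h, measureReal_prod_prod, probReal_univ, mul_one, expMeasure_real_Ioi hlam zero_le_one]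
    positivity
  have hmono : StrictMono fun i => (A i).1 := strictMono_nat_of_lt_succ fun i => by
    rw [fst_succ]; linarith [hgap (i + 1)]
  have h0 : 0 < (A 0).1 := by simpa [gap] using hgap 0
  refine ⟨fun i => h0.trans_le (hmono.monotone i.zero_le), hmono, ?_, ?_⟩
  · have key : ∀ K : ℕ, ∃ i, (K : ℝ) ≤ (A i).1 := by
      intro K
      induction K with
      | zero => exact ⟨0, by simpa using h0.le⟩
      | succ K ih =>
        obtain ⟨i, hi⟩ := ih
        obtain ⟨j, hj, hij⟩ := hlong.exists_gt i
        obtain ⟨j, rfl⟩ : ∃ k, j = k + 1 := ⟨j - 1, by omega⟩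
        have h2 := hmono.monotone (Nat.lt_succ_iff.1 hij)
        have h3 : 1 < gap A (j + 1) := hj
        refine ⟨j + 1, ?_⟩
        rw [fst_succ]
        push_cast
        linarith
    refine tendsto_atTop_atTop_of_monotone hmono.monotone fun x => ?_
    obtain ⟨K, hK⟩ := exists_nat_ge x
    obtain ⟨i, hi⟩ := key K
    exact ⟨i, hK.trans hi⟩
  · rintro (_ | _)
    exacts [infinite_of_tendsto_count hq hf, infinite_of_tendsto_count hp ht]

lemma ae_tendsto_countShort {lam p q : ℝ} (hlam : 0 < lam) (hp : 0 < p) (hq : 0 < q)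
    (hpq : p + q = 1) :
    ∀ᵐ A ∂arrivalLaw lam p q,
      Tendsto (fun n => (countShort A n : ℝ) / n) atTop (nhds p) := by
  have := ae_tendsto_count hlam hp hq hpq (fun x => x.2 = true)
    (measurable_snd (measurableSet_singleton true))
  rwa [prod_real_kind hlam, kindLaw_real_true hp] at this

/-- Gap and kind are independent, so the frequency is the exponential tail at `c` times `p`. -/
lemma ae_tendsto_countIsolated {lam p q c : ℝ} (hlam : 0 < lam) (hp : 0 < p) (hq : 0 < q)
    (hpq : p + q = 1) (hc : 0 ≤ c) :
    ∀ᵐ A ∂arrivalLaw lam p q,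
      Tendsto (fun n => (countIsolated c A n : ℝ) / n) atTop
        (nhds (Real.exp (-(lam * c)) * p)) := by
  classical
  have := isProbabilityMeasure_kindLaw hp hq hpq
  have h : {x : ℝ × Bool | x.2 = true ∧ c < x.1} = Ioi c ×ˢ {true} := by
    ext; simp [and_comm]
  have hlaw := ae_tendsto_count hlam hp hq hpq (fun x => x.2 = true ∧ c < x.1)
    (h ▸ measurableSet_Ioi.prod (measurableSet_singleton true))
  rw [h, measureReal_prod_prod, expMeasure_real_Ioi hlam hc, kindLaw_real_true hp] at hlaw
  filter_upwards [hlaw] with A hA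
  refine hA.congr fun n => ?_
  unfold countIsolated IsolatedShort
  congr!

lemma measurable_countShort (n : ℕ) : Measurable fun A => (countShort A n : ℝ) := by
  refine (measurable_from_top (f := fun n : ℕ => (n : ℝ))).comp (measurable_count (fun i => ?_) n)
  exact (measurable_pi_apply i).snd (measurableSet_singleton true)

lemma measurable_countIsolated (c : ℝ) (n : ℕ) :
    Measurable fun A => (countIsolated c A n : ℝ) := by
  classical
  exact (measurable_from_top (f := fun n : ℕ => (n : ℝ))).comp
    (measurable_count (measurableSet_isolatedShort c) n)

/-! ### The expected throughput -/

/-- Decreasing measurable sets with almost surely empty intersection eventually have small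
measure. -/
lemma exists_measure_lt {Ω : Type*} [MeasurableSpace Ω] {μ : Measure Ω} [IsFiniteMeasure μ]
    {s : ℕ → Set Ω} (hs : ∀ n, MeasurableSet (s n)) (hanti : Antitone s)
    (h : ∀ᵐ ω ∂μ, ∃ n, ω ∉ s n) {δ : ENNReal} (hδ : 0 < δ) : ∃ n, μ (s n) < δ := by
  have h0 : μ (⋂ n, s n) = 0 := by
    rw [ae_iff] at h
    convert h using 2
    ext
    simp
  have := tendsto_measure_iInter_atTop (fun n => (hs n).nullMeasurableSet) hanti
    ⟨0, measure_ne_top μ _⟩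
  rw [h0] at this
  exact (this.eventually_lt_const hδ).exists

/-- The constant `C` plus the two indicators is a measurable majorant, so measurability of `f`
itself is never needed. -/
lemma expectation_le {Ω : Type*} [MeasurableSpace Ω] {μ : Measure Ω} [IsProbabilityMeasure μ]
    {f : Ω → ℝ} {C : ℝ} {s s' : Set Ω} (hs : MeasurableSet s) (hs' : MeasurableSet s')
    (h1 : ∀ᵐ ω ∂μ, f ω ≤ 1) (hC : ∀ᵐ ω ∂μ, ω ∉ s → ω ∉ s' → f ω ≤ C) :
    expectation μ f ≤ ENNReal.ofReal C + (μ s + μ s') := by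
  refine iInf₂_le_of_le
    (fun ω => ENNReal.ofReal C + (s.indicator 1 ω + s'.indicator 1 ω))
    (Measurable.add (f := fun _ => ENNReal.ofReal C)
      (g := fun ω => s.indicator 1 ω + s'.indicator 1 ω) measurable_const
      (Measurable.add (f := s.indicator 1) (g := s'.indicator 1)
        (measurable_one.indicator hs) (measurable_one.indicator hs')))
    (iInf_le_of_le ?_ ?_)
  · filter_upwards [h1, hC] with ω h1 hC
    have h1' : ENNReal.ofReal (f ω) ≤ 1 := by simpa using h1
    by_cases hω : ω ∈ s
    · rw [indicator_of_mem hω]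
      exact h1'.trans (le_add_left le_self_add)
    by_cases hω' : ω ∈ s'
    · rw [indicator_of_mem hω']
      exact h1'.trans (le_add_left le_add_self)
    · exact (ENNReal.ofReal_le_ofReal (hC hω hω')).trans le_self_add
  · rw [lintegral_add_left measurable_const, lintegral_add_left (measurable_one.indicator hs),
      lintegral_indicator_one hs, lintegral_indicator_one hs', lintegral_const, measure_univ,
      mul_one]

lemma eventually_count_bounds {D κ c r p : ℝ}
    (hp : 2 * p < 1) (hr : D * lmin * p + κ < c * r)
    (hS : Tendsto (fun n => (countShort A n : ℝ) / n) atTop (nhds p))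
    (hG : Tendsto (fun n => (countIsolated c A n : ℝ) / n) atTop (nhds r)) :
    ∃ N, ∀ j ≥ N, 2 * (countShort A j : ℝ) ≤ j ∧
      D * lmin * countShort A j + κ * j ≤ c * countIsolated c A j := by
  have h1 := (hS.const_mul 2).eventually_lt_const hp
  have h2 := ((hS.const_mul (D * lmin)).add_const κ).eventually_lt (hG.const_mul c) hr
  obtain ⟨N, hN⟩ := eventually_atTop.1 ((h1.and h2).and (eventually_gt_atTop 0))
  refine ⟨N, fun j hj => ?_⟩
  obtain ⟨⟨h1, h2⟩, hj0⟩ := hN j hj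
  have hj0' : (0 : ℝ) < j := by exact_mod_cast hj0
  constructor
  · rw [mul_div_assoc', div_lt_one hj0'] at h1
    exact h1.le
  · rw [mul_div_assoc', mul_div_assoc', div_add' _ _ _ hj0'.ne',
      div_lt_div_iff_of_pos_right hj0'] at h2
    exact h2.le

/-- The almost sure bounds are made uniform outside events of probability below `δ / 2`: first `N`
from which the counts obey their limits, then `M` large enough to absorb the loss due to `N`, then
`T` by which packet `M` has arrived. -/
lemma eventually_expectation_le (hmin : 0 < lmin) (hlt : lmin < lmax) {lam p q D δ : ℝ}
    (hlam : 0 < lam) (hp : 0 < p) (hq : 0 < q) (hpq : p + q = 1) (hp2 : 2 * p < 1)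
    (hD : 0 < D) (hδ : 0 < δ)
    (hlamD : D * lmin < (lmax + lmin) * Real.exp (-(lam * (lmax + lmin)))) :
    ∀ᶠ t in atTop, expectation (arrivalLaw lam p q) (fun A =>
      throughputBy lmin lmax (slLength lmin lmax) A (slotErrors lmin lmax A) t) ≤
        ENNReal.ofReal (1 / D + δ) := by
  have := isProbabilityMeasure_arrivalLaw hlam hp hq hpq
  set μ := arrivalLaw lam p q
  set c := lmax + lmin with hc
  set θ := Real.exp (-(lam * c))
  have hc0 : 0 < c := by linarith
  -- Half the limiting surplus per packet; the other half makes the inequality between the limits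
  -- strict.
  set κ := (c * θ - D * lmin) * p / 2 with hκ
  have hκ0 : 0 < κ := by have := sub_pos.2 hlamD; positivity
  set Q : Pattern → ℕ → Prop := fun A j => 2 * (countShort A j : ℝ) ≤ j ∧
    D * lmin * countShort A j + κ * j ≤ c * countIsolated c A j with hQ
  have hQm (j : ℕ) : MeasurableSet {A | Q A j} := by
    have h1 := measurable_countShort j
    have h2 := measurable_countIsolated c j
    exact (measurableSet_le (h1.const_mul 2) measurable_const).inter
      (measurableSet_le ((h1.const_mul _).add_const _) (h2.const_mul _))
  have hδ2 : 0 < ENNReal.ofReal (δ / 2) := by simpa using hδ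
  have hreal := ae_isRealization hlam hp hq hpq
  obtain ⟨N, hN⟩ := exists_measure_lt (μ := μ) (s := fun N => {A | ¬ ∀ j ≥ N, Q A j})
    (fun N => by
      refine MeasurableSet.compl (s := {A | ∀ j ≥ N, Q A j}) ?_
      simp only [ofPred_forall]
      exact MeasurableSet.iInter fun j => MeasurableSet.iInter fun _ => hQm j)
    (fun N N' hNN A hA h => hA fun j hj => h j (hNN.trans hj))
    (by
      filter_upwards [ae_tendsto_countShort hlam hp hq hpq,
        ae_tendsto_countIsolated hlam hp hq hpq hc0.le] with A hS hG
      obtain ⟨N, hN⟩ := eventually_count_bounds (lmin := lmin) (D := D) (κ := κ) hp2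
        (by nlinarith [hκ0, hκ]) hS hG
      exact ⟨N, fun h => h hN⟩) hδ2
  obtain ⟨M, hNM, hM⟩ : ∃ M : ℕ, N ≤ M ∧ c * (N + 1) < κ * M := by
    obtain ⟨M, hM⟩ := exists_nat_gt (c * (N + 1) / κ)
    refine ⟨max N M, le_max_left _ _, ?_⟩
    rw [div_lt_iff₀' hκ0] at hM
    refine hM.trans_le (mul_le_mul_of_nonneg_left ?_ hκ0.le)
    exact_mod_cast le_max_right _ _
  have hW (t : ℝ) : MeasurableSet {A : Pattern | t < (A M).1} :=
    measurableSet_lt measurable_const (measurable_pi_apply M).fst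
  obtain ⟨T, hT⟩ := exists_measure_lt (μ := μ) (s := fun T : ℕ => {A : Pattern | (T : ℝ) < (A M).1})
    (fun T => hW T) (fun T T' hTT A (hA : (T' : ℝ) < _) => by
      have : (T : ℝ) ≤ T' := by exact_mod_cast hTT
      exact this.trans_lt hA)
    (Eventually.of_forall fun A => by
      obtain ⟨T, hT⟩ := exists_nat_ge (A M).1
      exact ⟨T, not_lt.2 hT⟩) hδ2
  filter_upwards [eventually_ge_atTop (T : ℝ)] with t ht
  have ht0 : 0 ≤ t := (Nat.cast_nonneg T).trans ht
  refine (expectation_le (C := 1 / D) (s := {A | ¬ ∀ j ≥ N, Q A j})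
    (s' := {A : Pattern | t < (A M).1}) ?_ (hW t) ?_ ?_).trans ?_
  · refine MeasurableSet.compl (s := {A | ∀ j ≥ N, Q A j}) ?_
    simp only [ofPred_forall]
    exact MeasurableSet.iInter fun j => MeasurableSet.iInter fun _ => hQm j
  · filter_upwards [hreal] with A hA
    exact throughputBy_slotErrors_le_one hmin hlt hA ht0
  · filter_upwards [hreal] with A hA h1 h2
    have h1' : ∀ j ≥ N, Q A j := not_not.1 h1
    exact throughputBy_slotErrors_le hmin hlt hA hD hκ0 hNM hM
      (fun j hj => ⟨by exact_mod_cast (h1' j hj).1, (h1' j hj).2⟩) ht0 (not_lt.1 h2)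
  · have hW' : μ {A : Pattern | t < (A M).1} < ENNReal.ofReal (δ / 2) :=
      (measure_mono fun A (hA : t < _) => ht.trans_lt hA).trans_lt hT
    calc _ ≤ ENNReal.ofReal (1 / D) + (ENNReal.ofReal (δ / 2) + ENNReal.ofReal (δ / 2)) := by
          gcongr
      _ = ENNReal.ofReal (1 / D + δ) := by
          rw [← ENNReal.ofReal_add (by positivity) (by positivity),
            ← ENNReal.ofReal_add (by positivity) (by positivity), add_halves]

end PacketScheduling

end

/-! ### Choice of the parameters -/

theorem mainTheorem9 (lmin lmax : ℝ) (hmin : 0 < lmin) (hlt : lmin < lmax)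
    (ρ : ℝ) (hρ : ρ = lmax / lmin)
    (ε : ℝ) (hε : 0 < ε) (hε' : 0 < (1 - ε) * ρ + 1) :
    ∃ lam p q : ℝ, 0 < lam ∧ 0 < p ∧ 0 < q ∧ p + q = 1 ∧
      PacketScheduling.relativeThroughput lmin lmax lam p q
          (PacketScheduling.slLength lmin lmax) ≤
        ENNReal.ofReal (1 / ((1 - ε) * ρ + 1) + ε) := by
  set D := (1 - ε) * ρ + 1 with hD
  set c := lmax + lmin with hc
  have hc0 : 0 < c := by linarith
  have hDc : D * lmin < c := by
    have h1 : D * lmin = (1 - ε) * lmax + lmin := by rw [hD, hρ]; field_simp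
    have h2 : 0 < ε * lmax := mul_pos hε (hmin.trans hlt)
    rw [h1, hc]
    linarith
  -- Chosen so that `c * (1 - δ)` is the midpoint of `D * lmin` and `c`. With `lam = δ / c` the
  -- isolation probability is `exp (-δ) ≥ 1 - δ`, which keeps `c * exp (-δ)` above `D * lmin`.
  set δ := (1 - D * lmin / c) / 2 with hδ
  have hcδ : c * δ = (c - D * lmin) / 2 := by rw [hδ]; field_simp
  have hδ0 : 0 < δ := pos_of_mul_pos_right (by rw [hcδ]; linarith) hc0.le
  have hlam : 0 < δ / c := div_pos hδ0 hc0
  -- The value `p = 1 / 4` matters only through `2 * p < 1`.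
  refine ⟨δ / c, 1 / 4, 3 / 4, hlam, by norm_num, by norm_num, by norm_num, ?_⟩
  refine iInf₂_le_of_le _ (PacketScheduling.isErrorFunction_slotErrors hmin hlt) ?_
  refine Filter.limsup_le_of_le (by isBoundedDefault)
    (PacketScheduling.eventually_expectation_le hmin hlt hlam (by norm_num) (by norm_num)
      (by norm_num) (by norm_num) hε' hε ?_)
  rw [← hc, div_mul_cancel₀ _ hc0.ne']
  have h1 : c * (1 - δ) ≤ c * Real.exp (-δ) :=
    mul_le_mul_of_nonneg_left (Real.one_sub_le_exp_neg δ) hc0.le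
  linarith
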